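/- Let $H$ be a separable complex Hilbert space, let $\mathcal M\subseteq \mathbb B(H)$ be a von Neumann algebra, and let $\Gamma$ be a group acting on $\mathcal M$ by $*$-automorphisms $\alpha_g$, $g\in\Gamma$. Let $\mathrm{SA}(\mathcal M)$ be the set of all von Neumann subalgebras of $\mathcal M$ (containing the unit of $\mathcal M$), with the Effros–Maréchal topology. This is the (metrizable) topology in which $\mathcal M_n\to\mathcal K$ if and only if $\liminf_n\mathcal M_n=\limsup_n\mathcal M_n=\mathcal K$, where $\liminf_n\mathcal M_n$ is the set of all $x\in\mathcal M$ that are strong-$*$ limits of norm-bounded sequences $(x_n)$ with $x_n\in\mathcal M_n$ for every $n$, and $\limsup_n\mathcal M_n$ is the von Neumann algebra generated by all $x\in\mathcal M$ that are weak operator limits of subsequences of such norm-bounded sequences; a subset of $\mathrm{SA}(\mathcal M)$ is closed if and only if it contains the limits of all convergent sequences of its elements. The group $\Gamma$ acts on $\mathrm{SA}(\mathcal M)$ by $g\cdot\mathcal K=\alpha_g(\mathcal K)$. For $\mathcal N\in\mathrm{SA}(\mathcal M)$ regard $\mathrm{SA}(\mathcal N)=\{\mathcal K\in\mathrm{SA}(\mathcal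 M):\mathcal K\subseteq\mathcal N\}$ as a subset of $\mathrm{SA}(\mathcal M)$. Let $\mu$ be an invariant random subalgebra (IRA) of $\mathcal M$, that is, a Borel probability measure on $\mathrm{SA}(\mathcal M)$ that is invariant under the action of $\Gamma$. Then there exists a unique minimal von Neumann subalgebra $\mathcal N\in\mathrm{SA}(\mathcal M)$ such that $\mu(\mathrm{SA}(\mathcal N))=1$. It is contained in every $\mathcal L\in\mathrm{SA}(\mathcal M)$ with $\mu(\mathrm{SA}(\mathcal L))=1$, and it is $\Gamma$-invariant: $\alpha_g(\mathcal N)=\mathcal N$ for all $g\in\Gamma$. (This $\mathcal N$ is called the normal closure of $\mu$.) -/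

import Mathlib

open Set Filter Topology MeasureTheory

namespace IRA

noncomputable section

universe u v

variable {H : Type u} [NormedAddCommGroup H] [InnerProductSpace ℂ H] [CompleteSpace H]

/-- The space `SA(M)` of all von Neumann subalgebras of `M` (with the same unit as `M`). -/
abbrev SA (M : VonNeumannAlgebra H) : Type u := {N : VonNeumannAlgebra H // N ≤ M}

/-- The von Neumann algebra generated by a set `s` of bounded operators: `(s ∪ s*)''`. -/
def generated (s : Set (H →L[ℂ] H)) : VonNeumannAlgebra H where
  toStarSubalgebra :=
    StarSubalgebra.centralizer ℂ (StarSubalgebra.centralizer ℂ s : Set (H →L[ℂ] H))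
  centralizer_centralizer' := by
    change Set.centralizer (Set.centralizer
      (StarSubalgebra.centralizer ℂ (StarSubalgebra.centralizer ℂ s : Set (H →L[ℂ] H)) :
        Set (H →L[ℂ] H))) =
      (StarSubalgebra.centralizer ℂ (StarSubalgebra.centralizer ℂ s : Set (H →L[ℂ] H)) :
        Set (H →L[ℂ] H))
    rw [StarSubalgebra.coe_centralizer_centralizer]
    exact Set.centralizer_centralizer_centralizer _

theorem coe_generated (s : Set (H →L[ℂ] H)) :
    (generated s : Set (H →L[ℂ] H)) = (s ∪ star s).centralizer.centralizer :=
  StarSubalgebra.coe_centralizer_centralizer ℂ s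

/-- Convergence of a sequence of operators in the weak operator topology. -/
def WOTendsto (x : ℕ → H →L[ℂ] H) (y : H →L[ℂ] H) : Prop :=
  ∀ ξ η : H, Tendsto (fun n => inner ℂ ξ (x n η)) atTop (𝓝 (inner ℂ ξ (y η)))

/-- Convergence of a sequence of operators in the strong-* operator topology. -/
def SOStarTendsto (x : ℕ → H →L[ℂ] H) (y : H →L[ℂ] H) : Prop :=
  ∀ ξ : H, Tendsto (fun n => x n ξ) atTop (𝓝 (y ξ)) ∧
    Tendsto (fun n => star (x n) ξ) atTop (𝓝 (star y ξ))

/-- `x ∈ ℓ^∞(ℕ, K n)`: a norm-bounded sequence with `x n ∈ K n` for every `n`. -/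
def IsBoundedSelection {M : VonNeumannAlgebra H} (K : ℕ → SA M) (x : ℕ → H →L[ℂ] H) : Prop :=
  (∀ n, x n ∈ (K n).1) ∧ ∃ C : ℝ, ∀ n, ‖x n‖ ≤ C

/-- `liminf K n`: the strong-* limits in `M` of bounded sequences `x n ∈ K n`. -/
def emLiminf {M : VonNeumannAlgebra H} (K : ℕ → SA M) : Set (H →L[ℂ] H) :=
  {y | y ∈ M ∧ ∃ x, IsBoundedSelection K x ∧ SOStarTendsto x y}

/-- The weak operator limit points in `M` (limits of subsequences) of bounded sequences
`x n ∈ K n`. -/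
def woLimitPoints {M : VonNeumannAlgebra H} (K : ℕ → SA M) : Set (H →L[ℂ] H) :=
  {y | y ∈ M ∧ ∃ x, IsBoundedSelection K x ∧ ∃ φ : ℕ → ℕ, StrictMono φ ∧ WOTendsto (x ∘ φ) y}

/-- `limsup K n`: the von Neumann algebra generated by the weak operator limit points of
bounded sequences `x n ∈ K n`. -/
def emLimsup {M : VonNeumannAlgebra H} (K : ℕ → SA M) : VonNeumannAlgebra H :=
  generated (woLimitPoints K)

/-- Effros-Maréchal convergence of sequences: `liminf K n = limsup K n = L`. -/
def EMTendsto {M : VonNeumannAlgebra H} (K : ℕ → SA M) (L : SA M) : Prop :=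
  emLiminf K = (L.1 : Set (H →L[ℂ] H)) ∧ emLimsup K = L.1

theorem generated_mono {s t : Set (H →L[ℂ] H)} (h : s ⊆ t) : generated s ≤ generated t := by
  change (generated s : Set (H →L[ℂ] H)) ⊆ generated t
  rw [coe_generated, coe_generated]
  exact Set.centralizer_subset (Set.centralizer_subset
    (Set.union_subset_union h (Set.preimage_mono h)))

theorem subset_generated (s : Set (H →L[ℂ] H)) : s ⊆ generated s := by
  rw [coe_generated]
  exact Set.subset_union_left.trans Set.subset_centralizer_centralizer

/-- Effros-Maréchal convergence passes to subsequences. -/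
theorem EMTendsto.comp {M : VonNeumannAlgebra H} {K : ℕ → SA M} {L : SA M}
    (h : EMTendsto K L) {φ : ℕ → ℕ} (hφ : StrictMono φ) : EMTendsto (K ∘ φ) L := by
  have h1 : emLiminf K ⊆ emLiminf (K ∘ φ) := by
    rintro y ⟨hy, x, ⟨hx, C, hC⟩, hlim⟩
    refine ⟨hy, x ∘ φ, ⟨fun n => hx (φ n), C, fun n => hC (φ n)⟩, fun ξ => ⟨?_, ?_⟩⟩
    · exact (hlim ξ).1.comp hφ.tendsto_atTop
    · exact (hlim ξ).2.comp hφ.tendsto_atTop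
  have h2 : emLiminf (K ∘ φ) ⊆ (emLimsup (K ∘ φ) : Set (H →L[ℂ] H)) := by
    refine Subset.trans ?_ (subset_generated _)
    rintro y ⟨hy, x, hx, hlim⟩
    exact ⟨hy, x, hx, id, strictMono_id, fun ξ η => tendsto_const_nhds.inner (hlim η).1⟩
  have h3 : emLimsup (K ∘ φ) ≤ emLimsup K := by
    refine generated_mono ?_
    rintro y ⟨hy, x, ⟨hx, C, hC⟩, ψ, hψ, hlim⟩
    have hext : ∀ k, Function.extend φ x 0 (φ k) = x k := hφ.injective.extend_apply x 0
    refine ⟨hy, Function.extend φ x 0, ⟨fun n => ?_, C, fun n => ?_⟩, φ ∘ ψ, hφ.comp hψ, ?_⟩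
    · by_cases hn : ∃ k, φ k = n
      · obtain ⟨k, rfl⟩ := hn
        rw [hext]
        exact hx k
      · rw [Function.extend_apply' _ _ _ hn]
        exact zero_mem _
    · by_cases hn : ∃ k, φ k = n
      · obtain ⟨k, rfl⟩ := hn
        rw [hext]
        exact hC k
      · rw [Function.extend_apply' _ _ _ hn]
        simpa using (norm_nonneg _).trans (hC 0)
    · intro ξ η
      simpa only [Function.comp_apply, hext] using hlim ξ η
  have h3' : (emLimsup (K ∘ φ) : Set (H →L[ℂ] H)) ⊆ emLimsup K := h3
  obtain ⟨ha, hb⟩ := h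
  rw [hb] at h3'
  rw [ha] at h1
  exact ⟨Subset.antisymm (h2.trans h3') h1,
    SetLike.coe_injective (Subset.antisymm h3' (h1.trans h2))⟩

/-- The Effros-Maréchal topology on `SA(M)`: a set is closed iff it contains the limits of all
Effros-Maréchal convergent sequences of its elements. (For `H` separable the Effros-Maréchal
topology is metrizable, so it is determined in this way by its convergent sequences.) -/
instance emTopology (M : VonNeumannAlgebra H) : TopologicalSpace (SA M) :=
  TopologicalSpace.ofClosed
    {F | ∀ (K : ℕ → SA M) (L : SA M), (∀ n, K n ∈ F) → EMTendsto K L → L ∈ F}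
    (fun _ _ h _ => (h 0).elim)
    (fun _ hA K L hK hL F hF => hA hF K L (fun n => hK n F hF) hL)
    (by
      intro A hA B hB K L hK hL
      by_cases hfr : ∃ᶠ n in atTop, K n ∈ A
      · obtain ⟨φ, hφ, hφA⟩ := extraction_of_frequently_atTop hfr
        exact Or.inl (hA _ L hφA (hL.comp hφ))
      · have hev : ∃ᶠ n in atTop, K n ∈ B :=
          ((not_frequently.1 hfr).mono fun n hn => (hK n).resolve_left hn).frequently
        obtain ⟨φ, hφ, hφB⟩ := extraction_of_frequently_atTop hev
        exact Or.inr (hB _ L hφB (hL.comp hφ)))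

theorem isClosed_iff {M : VonNeumannAlgebra H} {F : Set (SA M)} :
    IsClosed F ↔ ∀ (K : ℕ → SA M) (L : SA M), (∀ n, K n ∈ F) → EMTendsto K L → L ∈ F := by
  rw [← isOpen_compl_iff]
  change Fᶜᶜ ∈ {F : Set (SA M) |
    ∀ (K : ℕ → SA M) (L : SA M), (∀ n, K n ∈ F) → EMTendsto K L → L ∈ F} ↔ _
  rw [compl_compl]
  rfl

/-- The Borel structure of the Effros-Maréchal topology. -/
instance emMeasurableSpace (M : VonNeumannAlgebra H) : MeasurableSpace (SA M) := borel (SA M)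

instance emBorelSpace (M : VonNeumannAlgebra H) : BorelSpace (SA M) := ⟨rfl⟩

/-- The group of *-automorphisms of the von Neumann algebra `M`. -/
abbrev Aut (M : VonNeumannAlgebra H) : Type u := M.toStarSubalgebra ≃⋆ₐ[ℂ] M.toStarSubalgebra

/-- The image `θ(N)` of `N ∈ SA(M)` under a *-automorphism `θ` of `M`. -/
def image {M : VonNeumannAlgebra H} (θ : Aut M) (N : SA M) : Set (H →L[ℂ] H) :=
  {y | ∃ x : M.toStarSubalgebra, (x : H →L[ℂ] H) ∈ N.1 ∧ (θ x : H →L[ℂ] H) = y}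

/-- `SA(N)`, as a subset of `SA(M)`. -/
def subalgebras {M : VonNeumannAlgebra H} (N : SA M) : Set (SA M) := {K | K.1 ≤ N.1}

/-- `μ` is an invariant random subalgebra of `M` for the action `α` of `Γ` on `M`: a Borel
probability measure on `SA(M)` with `μ(g⁻¹ B) = μ(B)` for all `g ∈ Γ` and all Borel `B`, where
`g⁻¹ B = {N | α_g(N) ∈ B}`. -/
structure IsIRA {Γ : Type v} [Group Γ] {M : VonNeumannAlgebra H} (α : Γ →* Aut M)
    (μ : Measure (SA M)) : Prop where
  isProbabilityMeasure : IsProbabilityMeasure μ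
  invariant : ∀ (g : Γ) (B : Set (SA M)), MeasurableSet B →
    μ {N | ∃ K ∈ B, (K.1 : Set (H →L[ℂ] H)) = image (α g) N} = μ B

/-- `N` is a minimal element of `{L ∈ SA(M) | μ(SA(L)) = 1}`. -/
def IsNormalClosure {M : VonNeumannAlgebra H} (μ : Measure (SA M)) (N : SA M) : Prop :=
  Minimal (fun L : SA M => μ (subalgebras L) = 1) N

end

end IRA

/-! Let N be the intersection of all L with `μ (subalgebras L) = 1`. On a separable space countably
many L already have intersection N, and each `subalgebras L` is closed, hence Borel. So almost every
K lies in all of these L, hence in N, and N is the least such algebra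
(`exists_isLeast_measure_subalgebras_eq_one`). For invariance, invariance of μ gives α_g(N) full
measure as well, so leastness yields N ⊆ α_g(N); the inclusion for g⁻¹ gives equality. This requires
α_g(N) to be a von Neumann algebra (`exists_coe_eq_image`), and that is where most of the work lies:
α_g is only assumed to be an algebraic *-automorphism. A *-automorphism θ preserves order, and this
forces strong sequential continuity on bounded sets (`aut_tendsto_apply`). A self-adjoint x in the
bicommutant of θ(N) is a limit, on a dense sequence of vectors, of self-adjoint elements of θ(N)
with no norm bound. Their resolvents at i are contractions converging strongly to that of x, so θ⁻¹
carries this limit into N, and inverting puts θ⁻¹(x) in N. -/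

namespace IRA

/-! ### The operator monotone transform s(1 + s)⁻¹. -/

section CStar

variable {A : Type*} [CStarAlgebra A] [PartialOrder A] [StarOrderedRing A]

/-- The transform `s ↦ s (1 + s)⁻¹ = 1 - (1 + s)⁻¹`, operator monotone on positive elements. -/
noncomputable def frac (s : A) : A := 1 - Ring.inverse (1 + s)

theorem isStrictlyPositive_one_add {s : A} (hs : 0 ≤ s) : IsStrictlyPositive (1 + s) :=
  IsStrictlyPositive.add_nonneg isStrictlyPositive_one hs

theorem frac_mono {s t : A} (hs : 0 ≤ s) (hst : s ≤ t) : frac s ≤ frac t :=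
  sub_le_sub_left (CStarAlgebra.ringInverse_le_ringInverse (by gcongr)
    (isStrictlyPositive_one_add hs)) _

theorem frac_nonneg {s : A} (hs : 0 ≤ s) : 0 ≤ frac s := by
  simpa [frac] using frac_mono le_rfl hs

theorem frac_le_one {s : A} (hs : 0 ≤ s) : frac s ≤ 1 := by
  rw [frac, sub_le_self_iff]
  have h := isStrictlyPositive_one_add hs
  rw [Ring.inverse_of_isUnit h.isUnit]
  exact CFC.inv_nonneg_of_nonneg _ h.nonneg

theorem one_add_mul_frac {s : A} (hs : 0 ≤ s) : (1 + s) * frac s = s := by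
  rw [frac, mul_sub, Ring.mul_inverse_cancel _ (isStrictlyPositive_one_add hs).isUnit]
  simp

theorem frac_mul_one_add {s : A} (hs : 0 ≤ s) : frac s * (1 + s) = s := by
  rw [frac, sub_mul, Ring.inverse_mul_cancel _ (isStrictlyPositive_one_add hs).isUnit]
  simp

theorem commute_frac {s : A} (hs : 0 ≤ s) : Commute s (frac s) := by
  have h := (one_add_mul_frac hs).trans (frac_mul_one_add hs).symm
  rw [add_mul, mul_add, one_mul, mul_one] at h
  exact add_left_cancel h

theorem sub_frac {s : A} (hs : 0 ≤ s) : s - frac s = s * frac s := by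
  have h := one_add_mul_frac hs
  rw [add_mul, one_mul] at h
  exact sub_eq_of_eq_add' h.symm

theorem frac_le_self {s : A} (hs : 0 ≤ s) : frac s ≤ s := by
  rw [← sub_nonneg, sub_frac hs]
  exact (commute_frac hs).mul_nonneg hs (frac_nonneg hs)

/-- The difference of the two sides is (C - s) `frac s`, a product of commuting positive elements.
Thus on bounded sets a bound on `frac s` is a bound on s up to a constant. -/
theorem le_smul_frac {s : A} (hs : 0 ≤ s) {C : ℝ} (hC : s ≤ C • 1) :
    s ≤ (1 + C) • frac s := by
  have h : (1 + C) • frac s - s = (C • 1 - s) * frac s := by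
    rw [sub_mul, ← sub_frac hs, add_smul, smul_mul_assoc, one_mul, one_smul]
    abel
  rw [← sub_nonneg, h]
  refine Commute.mul_nonneg (sub_nonneg.2 hC) (frac_nonneg hs) ?_
  exact ((Commute.one_left _).smul_left C).sub_left (commute_frac hs)

end CStar

/-! ### Positive operators and monotone sequences. -/

section Operators

variable {H : Type*} [NormedAddCommGroup H] [InnerProductSpace ℂ H]

theorem re_inner_mono {a b : H →L[ℂ] H} (h : a ≤ b) (ξ : H) :
    (inner ℂ (a ξ) ξ).re ≤ (inner ℂ (b ξ) ξ).re := by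
  have := ((ContinuousLinearMap.isPositive_iff_complex _).1
    ((ContinuousLinearMap.le_def a b).1 h) ξ).2
  simpa [inner_sub_left] using this

theorem nonneg_of_tendsto {b : ℕ → H →L[ℂ] H} {c : H →L[ℂ] H}
    (hc : ∀ ξ, Tendsto (fun n => b n ξ) atTop (𝓝 (c ξ))) (hb : ∀ᶠ n in atTop, 0 ≤ b n) :
    0 ≤ c := by
  rw [ContinuousLinearMap.nonneg_iff_isPositive, ContinuousLinearMap.isPositive_iff_complex]
  intro ξ
  have h1 : Tendsto (fun n => inner ℂ (b n ξ) ξ) atTop (𝓝 (inner ℂ (c ξ) ξ)) :=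
    (hc ξ).inner tendsto_const_nhds
  have h2 := (Complex.continuous_re.tendsto _).comp h1
  have h3 : ∀ᶠ n in atTop, ((inner ℂ (b n ξ) ξ).re : ℂ) = inner ℂ (b n ξ) ξ ∧
      0 ≤ (inner ℂ (b n ξ) ξ).re := hb.mono fun n hn =>
    (ContinuousLinearMap.isPositive_iff_complex _).1
      ((ContinuousLinearMap.nonneg_iff_isPositive _).1 hn) ξ
  refine ⟨tendsto_nhds_unique (((Complex.continuous_ofReal.tendsto _).comp h2).congr' ?_) h1,
    ge_of_tendsto h2 (h3.mono fun n hn => hn.2)⟩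
  exact h3.mono fun n hn => hn.1

variable [CompleteSpace H]

/-- Factoring d through its square root upgrades control of the quadratic form to control of the
vectors dξ. -/
theorem norm_apply_sq_le {d : H →L[ℂ] H} (hd : 0 ≤ d) (ξ : H) :
    ‖d ξ‖ ^ 2 ≤ ‖d‖ * (inner ℂ (d ξ) ξ).re := by
  set s := CFC.sqrt d with hs
  have hsa : IsSelfAdjoint s := (CFC.sqrt_nonneg d).isSelfAdjoint
  have hss : s * s = d := CFC.sqrt_mul_sqrt_self d hd
  have h1 : ‖s‖ ^ 2 = ‖d‖ := by
    rw [← hss, sq, ← CStarRing.norm_star_mul_self (x := s), hsa.star_eq]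
  have h2 : (inner ℂ (d ξ) ξ).re = ‖s ξ‖ ^ 2 := by
    rw [← hss, mul_apply_eq_comp, ← hsa.star_eq, ContinuousLinearMap.star_eq_adjoint,
      ContinuousLinearMap.adjoint_inner_left, ← ContinuousLinearMap.star_eq_adjoint, hsa.star_eq]
    exact inner_self_eq_norm_sq (𝕜 := ℂ) _
  calc ‖d ξ‖ ^ 2 = ‖s (s ξ)‖ ^ 2 := by rw [← hss]; rfl
    _ ≤ (‖s‖ * ‖s ξ‖) ^ 2 := by gcongr; exact s.le_opNorm _
    _ = ‖d‖ * (inner ℂ (d ξ) ξ).re := by rw [mul_pow, h1, h2]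

theorem eq_zero_of_re_inner_eq_zero {d : H →L[ℂ] H} (hd : 0 ≤ d) {ξ : ℕ → H}
    (hξ : DenseRange ξ) (h : ∀ j, (inner ℂ (d (ξ j)) (ξ j)).re ≤ 0) : d = 0 := by
  have h0 : ∀ j, d (ξ j) = 0 := fun j => by
    have h1 := norm_apply_sq_le hd (ξ j)
    have h2 : ‖d (ξ j)‖ ^ 2 ≤ 0 :=
      h1.trans (mul_nonpos_of_nonneg_of_nonpos (norm_nonneg _) (h j))
    exact norm_eq_zero.1 (pow_eq_zero_iff two_ne_zero |>.1 (le_antisymm h2 (by positivity)))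
  have h3 : (d : H → H) = (0 : H →L[ℂ] H) :=
    hξ.equalizer d.continuous (0 : H →L[ℂ] H).continuous (funext h0)
  exact DFunLike.coe_injective h3

theorem le_of_tendsto_of_antitone {b : ℕ → H →L[ℂ] H} (hb : Antitone b) {c : H →L[ℂ] H}
    (hc : ∀ ξ, Tendsto (fun n => b n ξ) atTop (𝓝 (c ξ))) (n : ℕ) : c ≤ b n := by
  rw [← sub_nonneg]
  refine nonneg_of_tendsto (b := fun k => b n - b k) (fun ξ => ?_) ?_
  · simpa using (hc ξ).const_sub (b n ξ)
  · filter_upwards [eventually_ge_atTop n] with k hk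
    exact sub_nonneg.2 (hb hk)

/-- A decreasing sequence of positive operators converges strongly. -/
theorem exists_tendsto_of_antitone {b : ℕ → H →L[ℂ] H} (hb : Antitone b) (h0 : ∀ n, 0 ≤ b n) :
    ∃ c : H →L[ℂ] H, 0 ≤ c ∧ (∀ ξ, Tendsto (fun n => b n ξ) atTop (𝓝 (c ξ))) ∧
      ∀ n, c ≤ b n := by
  have hcauchy : ∀ ξ, CauchySeq fun n => b n ξ := by
    intro ξ
    set r : ℕ → ℝ := fun n => (inner ℂ (b n ξ) ξ).re
    have hr : Antitone r := fun m n hmn => re_inner_mono (hb hmn) ξ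
    have hr0 : BddBelow (range r) := ⟨0, by
      rintro _ ⟨n, rfl⟩
      simpa using re_inner_mono (h0 n) ξ⟩
    have hrc : CauchySeq r := (tendsto_atTop_ciInf hr hr0).cauchySeq
    -- The differences lie between 0 and `b 0`, so the Cauchy property of the real sequence r passes
    -- to the vectors.
    have key : ∀ m n, m ≤ n → ‖b m ξ - b n ξ‖ ^ 2 ≤ ‖b 0‖ * (r m - r n) := by
      intro m n hmn
      have hd : 0 ≤ b m - b n := sub_nonneg.2 (hb hmn)
      have hle : b m - b n ≤ b 0 := (sub_le_self _ (h0 n)).trans (hb (Nat.zero_le m))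
      have h1 := norm_apply_sq_le hd ξ
      have h2 : 0 ≤ r m - r n := sub_nonneg.2 (hr hmn)
      have h3 : (inner ℂ ((b m - b n) ξ) ξ).re = r m - r n := by simp [r]
      rw [h3] at h1
      refine h1.trans (mul_le_mul_of_nonneg_right ?_ h2)
      exact CStarAlgebra.norm_le_norm_of_nonneg_of_le hd hle
    rw [Metric.cauchySeq_iff'] at hrc ⊢
    intro ε hε
    obtain ⟨N, hN⟩ := hrc (ε ^ 2 / (‖b 0‖ + 1)) (by positivity)
    refine ⟨N, fun n hn => ?_⟩
    have h1 := key N n hn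
    have h2 := hN n hn
    rw [Real.dist_eq, abs_sub_comm, abs_of_nonneg (sub_nonneg.2 (hr hn)),
      lt_div_iff₀ (by positivity)] at h2
    rw [dist_comm, dist_eq_norm]
    refine lt_of_pow_lt_pow_left₀ 2 hε.le ?_
    nlinarith [sub_nonneg.2 (hr hn)]
  choose f hf using fun ξ => cauchySeq_tendsto_of_complete (hcauchy ξ)
  let c : H →L[ℂ] H := continuousLinearMapOfTendsto b (tendsto_pi_nhds.2 hf)
  have hc : ∀ ξ, Tendsto (fun n => b n ξ) atTop (𝓝 (c ξ)) := hf
  exact ⟨c, nonneg_of_tendsto hc (Eventually.of_forall h0), hc, le_of_tendsto_of_antitone hb hc⟩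

end Operators

/-! ### Normality of *-automorphisms of M. -/

section VonNeumann

variable {H : Type*} [NormedAddCommGroup H] [InnerProductSpace ℂ H] [CompleteSpace H]
  {M : VonNeumannAlgebra H}

theorem mem_iff_forall_commute {x : H →L[ℂ] H} : x ∈ M ↔ ∀ y ∈ M.commutant, Commute y x := by
  conv_lhs => rw [← VonNeumannAlgebra.commutant_commutant M]
  exact VonNeumannAlgebra.mem_commutant_iff

theorem sqrt_mem {x : H →L[ℂ] H} (hx : x ∈ M) : CFC.sqrt x ∈ M := by
  rw [mem_iff_forall_commute] at hx ⊢
  intro y hy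
  rw [CFC.sqrt_eq_cfc]
  exact ((hx y hy).symm.cfc_nnreal _).symm

theorem ringInverse_mem {x : H →L[ℂ] H} (hx : x ∈ M) : Ring.inverse x ∈ M := by
  by_cases hu : IsUnit x
  · rw [mem_iff_forall_commute] at hx ⊢
    intro y hy
    obtain ⟨u, rfl⟩ := hu
    rw [Ring.inverse_unit]
    exact (hx y hy).units_inv_right
  · rw [Ring.inverse_non_unit _ hu]
    exact zero_mem _

theorem frac_mem {x : H →L[ℂ] H} (hx : x ∈ M) : frac x ∈ M :=
  sub_mem (one_mem _) (ringInverse_mem (add_mem (one_mem _) hx))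

theorem smul_mem_vn (c : ℂ) {x : H →L[ℂ] H} (hx : x ∈ M) : c • x ∈ M :=
  M.toStarSubalgebra.smul_mem hx c

theorem mem_of_tendsto_apply {x : ℕ → H →L[ℂ] H} {y : H →L[ℂ] H} (hx : ∀ n, x n ∈ M)
    (hy : ∀ ξ, Tendsto (fun n => x n ξ) atTop (𝓝 (y ξ))) : y ∈ M := by
  rw [mem_iff_forall_commute]
  intro z hz
  ext ξ
  refine tendsto_nhds_unique ((z.continuous.tendsto _).comp (hy ξ)) ?_
  refine (hy (z ξ)).congr fun n => ?_
  exact (DFunLike.congr_fun (mem_iff_forall_commute.1 (hx n) z hz).eq ξ).symm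

/-- The square root of x stays in M, so positivity has the algebraic form s*s, which θ preserves. -/
theorem aut_nonneg (θ : Aut M) {x : M.toStarSubalgebra} (hx : 0 ≤ (x : H →L[ℂ] H)) :
    0 ≤ (θ x : H →L[ℂ] H) := by
  let s : M.toStarSubalgebra := ⟨CFC.sqrt (x : H →L[ℂ] H), sqrt_mem x.2⟩
  have hs : star s * s = x := Subtype.ext (by
    change star (CFC.sqrt (x : H →L[ℂ] H)) * CFC.sqrt (x : H →L[ℂ] H) = x
    rw [(CFC.sqrt_nonneg (x : H →L[ℂ] H)).isSelfAdjoint.star_eq]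
    exact CFC.sqrt_mul_sqrt_self _ hx)
  have h : (θ x : H →L[ℂ] H) = star (θ s : H →L[ℂ] H) * (θ s : H →L[ℂ] H) := by
    rw [← hs, map_mul, map_star]
    rfl
  rw [h]
  exact star_mul_self_nonneg _

theorem aut_mono (θ : Aut M) {x y : M.toStarSubalgebra} (h : (x : H →L[ℂ] H) ≤ y) :
    (θ x : H →L[ℂ] H) ≤ θ y := by
  have := aut_nonneg θ (x := y - x) (sub_nonneg.2 h)
  rw [map_sub] at this
  exact sub_nonneg.1 this

/-- A sequence of positive elements which is summable in a dense set of vector states is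
dominated, after applying `frac`, by a decreasing sequence with limit zero. -/
theorem exists_antitone_dominating {a : ℕ → H →L[ℂ] H} (haM : ∀ n, a n ∈ M)
    (ha : ∀ n, 0 ≤ a n) {ξ : ℕ → H}
    (hsum : ∀ j, Summable fun k => (inner ℂ (a k (ξ j)) (ξ j)).re) :
    ∃ b : ℕ → H →L[ℂ] H, (∀ m, b m ∈ M) ∧ Antitone b ∧ (∀ m, frac (a m) ≤ b m) ∧
      ∀ j, ∃ t : ℕ → ℝ, Tendsto t atTop (𝓝 0) ∧ ∀ m, (inner ℂ (b m (ξ j)) (ξ j)).re ≤ t m := by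
  set s : ℕ → ℕ → H →L[ℂ] H := fun m n => ∑ k ∈ Finset.Ico m n, a k with hs
  have hs0 : ∀ m n, 0 ≤ s m n := fun m n => Finset.sum_nonneg fun k _ => ha k
  have hsn : ∀ m, Monotone (s m) := fun m n n' h =>
    Finset.sum_le_sum_of_subset_of_nonneg (Finset.Ico_subset_Ico_right h) fun k _ _ => ha k
  have hsm : ∀ m m' n, m ≤ m' → s m' n ≤ s m n := fun m m' n h =>
    Finset.sum_le_sum_of_subset_of_nonneg (Finset.Ico_subset_Ico_left h) fun k _ _ => ha k
  have hlim : ∀ m, ∃ e : H →L[ℂ] H, 0 ≤ e ∧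
      (∀ η, Tendsto (fun n => (1 - frac (s m n)) η) atTop (𝓝 (e η))) ∧
      ∀ n, e ≤ 1 - frac (s m n) := fun m =>
    exists_tendsto_of_antitone
      (fun n n' h => sub_le_sub_left (frac_mono (hs0 m n) (hsn m h)) _)
      (fun n => sub_nonneg.2 (frac_le_one (hs0 m n)))
  choose e he0 he hle using hlim
  have hb : ∀ m η, Tendsto (fun n => frac (s m n) η) atTop (𝓝 ((1 - e m) η)) := by
    intro m η
    simpa using (he m η).const_sub η
  -- `1 - e m` is the strong limit over n of `frac (s m n)`. The sums `s m n` may be unbounded in n,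
  -- but `frac` keeps them below 1, so this limit exists.
  refine ⟨fun m => 1 - e m, fun m => ?_, ?_, fun m => ?_, fun j => ?_⟩
  · exact mem_of_tendsto_apply (fun n => frac_mem (sum_mem fun k _ => haM k)) (hb m)
  · intro m m' h
    rw [← sub_nonneg]
    refine nonneg_of_tendsto (b := fun n => frac (s m n) - frac (s m' n)) (fun η => ?_) ?_
    · exact (hb m η).sub (hb m' η)
    · exact Eventually.of_forall fun n => sub_nonneg.2 (frac_mono (hs0 _ _) (hsm m m' n h))
  · have h1 : s m (m + 1) = a m := by simp [hs]
    rw [← h1]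
    exact le_sub_comm.1 (hle m (m + 1))
  -- Since `frac s ≤ s`, the tail of the convergent series bounds the state.
  · refine ⟨_, tendsto_sum_nat_add fun k => (inner ℂ (a k (ξ j)) (ξ j)).re, fun m => ?_⟩
    have h1 : Tendsto (fun n => (inner ℂ (frac (s m n) (ξ j)) (ξ j)).re) atTop
        (𝓝 (inner ℂ ((1 - e m) (ξ j)) (ξ j)).re) :=
      (Complex.continuous_re.tendsto _).comp ((hb m (ξ j)).inner tendsto_const_nhds)
    refine le_of_tendsto h1 (Eventually.of_forall fun n => ?_)
    refine (re_inner_mono (frac_le_self (hs0 m n)) (ξ j)).trans ?_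
    have h2 : (inner ℂ (s m n (ξ j)) (ξ j)).re =
        ∑ k ∈ Finset.range (n - m), (inner ℂ (a (k + m) (ξ j)) (ξ j)).re := by
      simp only [hs, sum_apply, sum_inner, Complex.re_sum,
        Finset.sum_Ico_eq_sum_range, add_comm m]
    rw [h2]
    refine Summable.sum_le_tsum _ (fun k _ => ?_)
      ((summable_nat_add_iff (f := fun k => (inner ℂ (a k (ξ j)) (ξ j)).re) m).2 (hsum j))
    simpa using re_inner_mono (ha (k + m)) (ξ j)

/-- With b the decreasing dominating sequence, θ(b n) decreases to some c ≥ 0 in M. Then θ⁻¹(c) lies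
below every b n, so it vanishes, and c = 0. The bound θ(a n) ≤ (1 + C) θ(b n) finishes. -/
theorem aut_tendsto_re_inner_of_summable (θ : Aut M) {a : ℕ → M.toStarSubalgebra}
    (ha : ∀ n, 0 ≤ (a n : H →L[ℂ] H)) {C : ℝ} (hC0 : 0 ≤ C)
    (hC : ∀ n, (a n : H →L[ℂ] H) ≤ C • 1) {ξ : ℕ → H} (hξ : DenseRange ξ)
    (hsum : ∀ j, Summable fun k => (inner ℂ ((a k : H →L[ℂ] H) (ξ j)) (ξ j)).re) (η : H) :
    Tendsto (fun n => (inner ℂ ((θ (a n) : H →L[ℂ] H) η) η).re) atTop (𝓝 0) := by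
  obtain ⟨b, hbM, hb, hab, ht⟩ := exists_antitone_dominating (fun n => (a n).2) ha hsum
  have hb0 : ∀ n, 0 ≤ b n := fun n => (frac_nonneg (ha n)).trans (hab n)
  let B : ℕ → M.toStarSubalgebra := fun n => ⟨b n, hbM n⟩
  obtain ⟨c, hc0, hc, hcle⟩ := exists_tendsto_of_antitone (b := fun n => (θ (B n) : H →L[ℂ] H))
    (fun m n h => aut_mono θ (x := B n) (y := B m) (hb h)) (fun n => aut_nonneg θ (hb0 n))
  have hcM : c ∈ M := mem_of_tendsto_apply (fun n => (θ (B n)).2) hc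
  let c' : M.toStarSubalgebra := ⟨c, hcM⟩
  have hd0 : 0 ≤ (θ.symm c' : H →L[ℂ] H) := aut_nonneg θ.symm hc0
  have hdle : ∀ n, (θ.symm c' : H →L[ℂ] H) ≤ b n := fun n => by
    have := aut_mono θ.symm (x := c') (y := θ (B n)) (hcle n)
    rwa [StarAlgEquiv.symm_apply_apply] at this
  have hd : (θ.symm c' : H →L[ℂ] H) = 0 := by
    refine eq_zero_of_re_inner_eq_zero hd0 hξ fun j => ?_
    obtain ⟨t, ht0, ht⟩ := ht j
    exact ge_of_tendsto' ht0 fun n => (re_inner_mono (hdle n) (ξ j)).trans (ht n)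
  have hc'0 : c' = 0 := by
    rw [← θ.apply_symm_apply c', show θ.symm c' = 0 from Subtype.ext hd, map_zero]
  have hcz : c = 0 := congrArg Subtype.val hc'0
  have hlim : Tendsto (fun n => (1 + C) * (inner ℂ ((θ (B n) : H →L[ℂ] H) η) η).re) atTop
      (𝓝 0) := by
    have h1 : Tendsto (fun n => (inner ℂ ((θ (B n) : H →L[ℂ] H) η) η).re) atTop
        (𝓝 (inner ℂ (c η) η).re) :=
      (Complex.continuous_re.tendsto _).comp ((hc η).inner tendsto_const_nhds)
    simpa [hcz] using h1.const_mul (1 + C)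
  refine squeeze_zero (fun n => ?_) (fun n => ?_) hlim
  · simpa using re_inner_mono (aut_nonneg θ (ha n)) η
  · have h1 : (a n : H →L[ℂ] H) ≤ ((((1 + C : ℝ) : ℂ) • B n : M.toStarSubalgebra) : H →L[ℂ] H) := by
      change (a n : H →L[ℂ] H) ≤ ((1 + C : ℝ) : ℂ) • b n
      rw [Complex.coe_smul]
      exact (le_smul_frac (ha n) (hC n)).trans
        (smul_le_smul_of_nonneg_left (hab n) (by positivity))
    have h2 := re_inner_mono (aut_mono θ h1) η
    rw [map_smul] at h2
    refine h2.trans_eq ?_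
    change (inner ℂ ((((1 + C : ℝ) : ℂ) • (θ (B n) : H →L[ℂ] H)) η) η).re = _
    rw [smul_apply, inner_smul_left, Complex.conj_ofReal, Complex.re_ofReal_mul]

theorem exists_strictMono_summable {r : ℕ → ℕ → ℝ} (h0 : ∀ j n, 0 ≤ r j n)
    (h : ∀ j, Tendsto (r j) atTop (𝓝 0)) :
    ∃ φ : ℕ → ℕ, StrictMono φ ∧ ∀ j, Summable fun k => r j (φ k) := by
  obtain ⟨φ, hφ, hlt⟩ := extraction_forall_of_eventually
    (P := fun n k => ∀ j ∈ Finset.range (n + 1), r j k < (1 / 2 : ℝ) ^ n) fun n =>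
      (Filter.eventually_all_finset _).2 fun j _ => (h j).eventually_lt_const (by positivity)
  refine ⟨φ, hφ, fun j => ?_⟩
  -- The geometric bound for index j holds only from the j-th term on.
  rw [← summable_nat_add_iff j]
  refine Summable.of_nonneg_of_le (fun k => h0 _ _) (fun k => (hlt (k + j) j ?_).le)
    ((summable_nat_add_iff j).2 summable_geometric_two)
  simp

/-- `*`-automorphisms are sequentially strongly continuous on bounded sets. -/
theorem aut_tendsto_apply [TopologicalSpace.SeparableSpace H] (θ : Aut M)
    {x : ℕ → M.toStarSubalgebra} {C : ℝ} (hC : ∀ n, ‖(x n : H →L[ℂ] H)‖ ≤ C)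
    (hx : ∀ ξ, Tendsto (fun n => (x n : H →L[ℂ] H) ξ) atTop (𝓝 0)) (η : H) :
    Tendsto (fun n => (θ (x n) : H →L[ℂ] H) η) atTop (𝓝 0) := by
  have hC0 : 0 ≤ C := (norm_nonneg _).trans (hC 0)
  have hnorm : ∀ (y : M.toStarSubalgebra) (ξ : H),
      (inner ℂ (((star y * y : M.toStarSubalgebra) : H →L[ℂ] H) ξ) ξ).re =
        ‖(y : H →L[ℂ] H) ξ‖ ^ 2 := by
    intro y ξ
    change (inner ℂ ((star (y : H →L[ℂ] H)) ((y : H →L[ℂ] H) ξ)) ξ).re = _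
    rw [ContinuousLinearMap.star_eq_adjoint, ContinuousLinearMap.adjoint_inner_left]
    exact inner_self_eq_norm_sq (𝕜 := ℂ) _
  have hle : ∀ n, ((star (x n) * x n : M.toStarSubalgebra) : H →L[ℂ] H) ≤ (C ^ 2) • 1 := by
    intro n
    change star (x n : H →L[ℂ] H) * (x n : H →L[ℂ] H) ≤ _
    have h1 := (IsSelfAdjoint.star_mul_self (x n : H →L[ℂ] H)).le_algebraMap_norm_self
    rw [CStarRing.norm_star_mul_self, Algebra.algebraMap_eq_smul_one] at h1
    refine h1.trans (smul_le_smul_of_nonneg_right ?_ zero_le_one)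
    rw [← sq]
    gcongr
    exact hC n
  -- Summability is available only after thinning, so each subsequence is thinned further.
  refine tendsto_of_subseq_tendsto fun ns hns => ?_
  let ξ := TopologicalSpace.denseSeq H
  obtain ⟨φ, -, hφ⟩ := exists_strictMono_summable
    (r := fun j n => ‖(x (ns n) : H →L[ℂ] H) (ξ j)‖ ^ 2) (fun _ _ => by positivity) (fun j => by
      simpa using (((hx (ξ j)).comp hns).norm).pow 2)
  refine ⟨φ, ?_⟩
  have key := aut_tendsto_re_inner_of_summable θ
    (a := fun k => star (x (ns (φ k))) * x (ns (φ k)))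
    (fun k => star_mul_self_nonneg (x (ns (φ k)) : H →L[ℂ] H)) (by positivity)
    (fun k => hle _) (TopologicalSpace.denseRange_denseSeq H)
    (fun j => by simpa only [hnorm] using hφ j) η
  simp only [map_mul, map_star, hnorm] at key
  rw [tendsto_zero_iff_norm_tendsto_zero]
  simpa using key.sqrt

end VonNeumann

/-! ### Self-adjoint approximation in the bicommutant, and resolvents. -/

section Density

/-- This is the double orthogonal complement for the real inner product Re⟨·,·⟩. The real version is
needed because self-adjoint elements form only a real subspace. -/
theorem mem_closure_of_forall_re_inner_eq_zero {E : Type*} [NormedAddCommGroup E]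
    [InnerProductSpace ℂ E] [CompleteSpace E] (S : AddSubgroup E)
    (hS : ∀ (r : ℝ), ∀ w ∈ S, (r : ℂ) • w ∈ S) {v : E}
    (h : ∀ ζ, (∀ w ∈ S, (inner ℂ ζ w).re = 0) → (inner ℂ ζ v).re = 0) :
    v ∈ closure (S : Set E) := by
  let _ : InnerProductSpace ℝ E := InnerProductSpace.complexToReal
  let T : Submodule ℝ E := { S with smul_mem' := fun r w hw => hS r w hw }
  have hv : v ∈ Tᗮᗮ := by
    rw [Submodule.mem_orthogonal]
    intro ζ hζ
    rw [real_inner_eq_re_inner ℂ]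
    refine h ζ fun w hw => ?_
    have h1 := (Submodule.mem_orthogonal' T ζ).1 hζ w hw
    rwa [real_inner_eq_re_inner ℂ] at h1
  rw [Submodule.orthogonal_orthogonal_eq_closure] at hv
  exact hv

variable {H : Type*} [NormedAddCommGroup H] [InnerProductSpace ℂ H]

/-- The finite direct sum of copies of `H`, as a Hilbert space. -/
abbrev Amplification (ι H : Type*) [Fintype ι] : Type _ := PiLp 2 fun _ : ι => H

section Amplification

variable {ι : Type*} [Fintype ι]

/-- The diagonal operator `a ⊕ ⋯ ⊕ a`. -/
noncomputable def diag (a : H →L[ℂ] H) : Amplification ι H →L[ℂ] Amplification ι H where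
  toFun v := WithLp.toLp 2 fun i => a (v i)
  map_add' v w := by ext i; simp
  map_smul' c v := by ext i; simp
  cont := by fun_prop

@[simp] theorem diag_apply (a : H →L[ℂ] H) (v : Amplification ι H) (i : ι) :
    diag a v i = a (v i) := rfl

/-- The inclusion of a summand. -/
noncomputable def summand [DecidableEq ι] (j : ι) : H →L[ℂ] Amplification ι H :=
  ((PiLp.continuousLinearEquiv 2 ℂ fun _ : ι => H).symm : (ι → H) →L[ℂ] Amplification ι H) ∘L
    ContinuousLinearMap.single ℂ (fun _ : ι => H) j

theorem summand_apply [DecidableEq ι] (j : ι) (h : H) (i : ι) :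
    summand j h i = if i = j then h else 0 := by
  change (Pi.single j h : ι → H) i = _
  exact Pi.single_apply j h i

theorem sum_summand [DecidableEq ι] (v : Amplification ι H) : ∑ j, summand j (v j) = v := by
  ext i
  simp [summand_apply]

theorem diag_summand [DecidableEq ι] (a : H →L[ℂ] H) (j : ι) (h : H) :
    diag a (summand j h) = summand j (a h) := by
  ext i
  rw [diag_apply, summand_apply, summand_apply, apply_ite a, map_zero]

end Amplification

theorem tendsto_apply_of_denseRange {T : ℕ → H →L[ℂ] H} {C : ℝ} (hC : ∀ n, ‖T n‖ ≤ C)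
    {ξ : ℕ → H} (hξ : DenseRange ξ) (h : ∀ j, Tendsto (fun n => T n (ξ j)) atTop (𝓝 0)) (η : H) :
    Tendsto (fun n => T n η) atTop (𝓝 0) := by
  have hC0 : 0 ≤ C := (norm_nonneg _).trans (hC 0)
  rw [Metric.tendsto_atTop]
  intro ε hε
  obtain ⟨j, hj⟩ := hξ.exists_dist_lt η (ε := ε / (2 * (C + 1))) (by positivity)
  obtain ⟨N, hN⟩ := Metric.tendsto_atTop.1 (h j) (ε / 2) (by positivity)
  refine ⟨N, fun n hn => ?_⟩
  have h1 := hN n hn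
  rw [dist_zero_right] at h1 ⊢
  rw [dist_eq_norm, lt_div_iff₀ (by positivity)] at hj
  have h2 : ‖T n (η - ξ j)‖ ≤ C * ‖η - ξ j‖ := (T n).le_of_opNorm_le (hC n) _
  have h3 : T n η = T n (η - ξ j) + T n (ξ j) := by rw [← map_add, sub_add_cancel]
  rw [h3]
  refine (norm_add_le _ _).trans_lt ?_
  nlinarith [norm_nonneg (η - ξ j)]

variable [CompleteSpace H]

theorem inner_diag_left {ι : Type*} [Fintype ι] (a : H →L[ℂ] H) (v w : Amplification ι H) :
    inner ℂ (diag a v) w = inner ℂ v (diag (star a) w) := by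
  simp only [PiLp.inner_apply, diag_apply, ContinuousLinearMap.star_eq_adjoint,
    ContinuousLinearMap.adjoint_inner_right]

/-- The strong form of the double commutant theorem, for finitely many vectors. -/
theorem exists_seq_tendsto_of_mem_bicommutant {ι : Type*} [Fintype ι]
    (P : StarSubalgebra ℂ (H →L[ℂ] H)) {x : H →L[ℂ] H}
    (hx : x ∈ (P : Set (H →L[ℂ] H)).centralizer.centralizer) (ξ : ι → H) :
    ∃ a : ℕ → H →L[ℂ] H, (∀ n, a n ∈ P) ∧
      ∀ i, Tendsto (fun n => a n (ξ i)) atTop (𝓝 (x (ξ i))) := by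
  classical
  let v₀ : Amplification ι H := WithLp.toLp 2 ξ
  let V : Submodule ℂ (Amplification ι H) :=
    { carrier := {w | ∃ a ∈ P, diag a v₀ = w}
      add_mem' := by
        rintro _ _ ⟨a, ha, rfl⟩ ⟨b, hb, rfl⟩
        exact ⟨a + b, add_mem ha hb, by ext i; simp⟩
      zero_mem' := ⟨0, zero_mem _, by ext i; simp⟩
      smul_mem' := by
        rintro c _ ⟨a, ha, rfl⟩
        exact ⟨c • a, P.smul_mem ha c, by ext i; simp⟩ }
  let W := V.topologicalClosure
  have hinv : ∀ a ∈ P, ∀ w ∈ W, diag a w ∈ W := by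
    intro a ha w hw
    refine map_mem_closure (diag a).continuous hw ?_
    rintro _ ⟨b, hb, rfl⟩
    exact ⟨a * b, mul_mem ha hb, rfl⟩
  have hcomm : ∀ a ∈ P, ∀ v, W.starProjection (diag a v) = diag a (W.starProjection v) := by
    intro a ha v
    refine Submodule.eq_starProjection_of_mem_of_inner_eq_zero
      (hinv a ha _ (W.starProjection_apply_mem v)) fun w hw => ?_
    rw [← map_sub, inner_diag_left]
    exact Submodule.starProjection_inner_eq_zero _ _ (hinv _ (star_mem ha) w hw)
  -- The matrix entries of the projection onto W lie in the commutant of P, so x commutes with each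
  -- of them and its amplification preserves W.
  let q : ι → ι → H →L[ℂ] H := fun i j =>
    PiLp.proj 2 (fun _ : ι => H) i ∘L W.starProjection ∘L summand j
  have hq : ∀ i j, q i j ∈ (P : Set (H →L[ℂ] H)).centralizer := by
    intro i j a ha
    ext h
    change a (W.starProjection (summand j h) i) = W.starProjection (summand j (a h)) i
    rw [← diag_summand, hcomm a ha, diag_apply]
  have hentry : ∀ u i, W.starProjection u i = ∑ j, q i j (u j) := by
    intro u i
    conv_lhs => rw [← sum_summand u]
    simp [q]
  have hxcomm : ∀ v, W.starProjection (diag x v) = diag x (W.starProjection v) := by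
    intro v
    ext i
    rw [diag_apply, hentry, hentry, map_sum]
    exact Finset.sum_congr rfl fun j _ => DFunLike.congr_fun (hx (q i j) (hq i j)) (v j)
  have hv₀ : v₀ ∈ W := V.le_topologicalClosure ⟨1, one_mem _, rfl⟩
  have hmem : diag x v₀ ∈ closure (V : Set (Amplification ι H)) := by
    change diag x v₀ ∈ W
    rw [← Submodule.starProjection_eq_self_iff.2 hv₀, ← hxcomm]
    exact W.starProjection_apply_mem _
  obtain ⟨w, hw, hlim⟩ := mem_closure_iff_seq_limit.1 hmem
  choose a ha haw using hw
  refine ⟨a, ha, fun i => ?_⟩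
  have := ((PiLp.proj (𝕜 := ℂ) 2 (fun _ : ι => H) i).continuous.tendsto _).comp hlim
  refine this.congr fun n => ?_
  rw [Function.comp_apply, ← haw]
  rfl

/-- A self-adjoint element of the bicommutant is approximated by self-adjoint elements. -/
theorem exists_selfAdjoint_seq_of_mem_bicommutant {ι : Type*} [Fintype ι]
    (P : StarSubalgebra ℂ (H →L[ℂ] H)) {x : H →L[ℂ] H}
    (hx : x ∈ (P : Set (H →L[ℂ] H)).centralizer.centralizer) (hxs : IsSelfAdjoint x)
    (ξ : ι → H) :
    ∃ a : ℕ → H →L[ℂ] H, (∀ n, a n ∈ P ∧ IsSelfAdjoint (a n)) ∧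
      ∀ i, Tendsto (fun n => a n (ξ i)) atTop (𝓝 (x (ξ i))) := by
  let S : AddSubgroup (Amplification ι H) :=
    { carrier := {w | ∃ a, (a ∈ P ∧ IsSelfAdjoint a) ∧ WithLp.toLp 2 (fun i => a (ξ i)) = w}
      add_mem' := by
        rintro _ _ ⟨a, ⟨ha, ha'⟩, rfl⟩ ⟨b, ⟨hb, hb'⟩, rfl⟩
        exact ⟨a + b, ⟨add_mem ha hb, ha'.add hb'⟩, rfl⟩
      zero_mem' := ⟨0, ⟨zero_mem _, .zero _⟩, rfl⟩
      neg_mem' := by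
        rintro _ ⟨a, ⟨ha, ha'⟩, rfl⟩
        exact ⟨-a, ⟨neg_mem ha, ha'.neg⟩, rfl⟩ }
  have hmem : (WithLp.toLp 2 (fun i => x (ξ i)) : Amplification ι H) ∈
      closure (S : Set (Amplification ι H)) := by
    refine mem_closure_of_forall_re_inner_eq_zero S ?_ fun ζ hζ => ?_
    · rintro r _ ⟨a, ⟨ha, ha'⟩, rfl⟩
      refine ⟨(r : ℂ) • a, ⟨P.smul_mem ha _, ?_⟩, rfl⟩
      exact IsSelfAdjoint.smul (Complex.conj_ofReal r) ha'
    -- Approximating on ζ as well controls ⟨ζ, (a n)* ξ⟩, so that ζ can be tested against the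
    -- self-adjoint element a n + (a n)*.
    · obtain ⟨a, ha, hlim⟩ := exists_seq_tendsto_of_mem_bicommutant P hx (Sum.elim ξ ζ)
      have h0 : ∀ n, ∑ i, ((inner ℂ (ζ i) (a n (ξ i))).re + (inner ℂ (a n (ζ i)) (ξ i)).re) = 0 := by
        intro n
        have h1 := hζ _ ⟨a n + star (a n), ⟨add_mem (ha n) (star_mem (ha n)),
          IsSelfAdjoint.add_star_self _⟩, rfl⟩
        simpa [PiLp.inner_apply, inner_add_right, ContinuousLinearMap.star_eq_adjoint,
          ContinuousLinearMap.adjoint_inner_right] using h1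
      have hl : Tendsto (fun n => ∑ i, ((inner ℂ (ζ i) (a n (ξ i))).re +
          (inner ℂ (a n (ζ i)) (ξ i)).re)) atTop
          (𝓝 (∑ i, ((inner ℂ (ζ i) (x (ξ i))).re + (inner ℂ (x (ζ i)) (ξ i)).re))) := by
        refine tendsto_finsetSum _ fun i _ => Tendsto.add ?_ ?_
        · exact (Complex.continuous_re.tendsto _).comp
            (tendsto_const_nhds.inner (hlim (Sum.inl i)))
        · exact (Complex.continuous_re.tendsto _).comp
            ((hlim (Sum.inr i)).inner tendsto_const_nhds)
      simp only [h0] at hl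
      have h2 := tendsto_nhds_unique hl tendsto_const_nhds
      have h3 : ∀ i, inner ℂ (x (ζ i)) (ξ i) = inner ℂ (ζ i) (x (ξ i)) := fun i => by
        conv_lhs => rw [← hxs.star_eq]
        rw [ContinuousLinearMap.star_eq_adjoint, ContinuousLinearMap.adjoint_inner_left]
      simp only [h3, Finset.sum_add_distrib] at h2
      rw [PiLp.inner_apply, Complex.re_sum]
      change ∑ i, (inner ℂ (ζ i) (x (ξ i))).re = 0
      linarith
  obtain ⟨w, hw, hlim⟩ := mem_closure_iff_seq_limit.1 hmem
  choose a ha haw using hw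
  refine ⟨a, ha, fun i => ?_⟩
  have := ((PiLp.proj (𝕜 := ℂ) 2 (fun _ : ι => H) i).continuous.tendsto _).comp hlim
  refine this.congr fun n => ?_
  rw [Function.comp_apply, ← haw]
  rfl

/-- The n-th term is chosen within 1/(n+1) on the first n vectors. No norm bound is obtained;
passing to resolvents compensates for this. -/
theorem exists_selfAdjoint_seq_of_mem_bicommutant_nat
    (P : StarSubalgebra ℂ (H →L[ℂ] H)) {x : H →L[ℂ] H}
    (hx : x ∈ (P : Set (H →L[ℂ] H)).centralizer.centralizer) (hxs : IsSelfAdjoint x)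
    (ξ : ℕ → H) :
    ∃ a : ℕ → H →L[ℂ] H, (∀ n, a n ∈ P ∧ IsSelfAdjoint (a n)) ∧
      ∀ j, Tendsto (fun n => a n (ξ j)) atTop (𝓝 (x (ξ j))) := by
  have h : ∀ n : ℕ, ∃ a, (a ∈ P ∧ IsSelfAdjoint a) ∧
      ∀ j < n, dist (a (ξ j)) (x (ξ j)) < 1 / ((n : ℝ) + 1) := by
    intro n
    obtain ⟨a, ha, hlim⟩ :=
      exists_selfAdjoint_seq_of_mem_bicommutant P hx hxs fun i : Fin n => ξ i
    have hev : ∀ᶠ k in atTop, ∀ i : Fin n, dist (a k (ξ i)) (x (ξ i)) < 1 / ((n : ℝ) + 1) :=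
      eventually_all.2 fun i => (tendsto_iff_dist_tendsto_zero.1 (hlim i)).eventually_lt_const
        (by positivity)
    obtain ⟨k, hk⟩ := hev.exists
    exact ⟨a k, ha k, fun j hj => hk ⟨j, hj⟩⟩
  choose a ha hdist using h
  refine ⟨a, ha, fun j => ?_⟩
  rw [tendsto_iff_dist_tendsto_zero]
  refine squeeze_zero' (Eventually.of_forall fun _ => dist_nonneg) ?_
    tendsto_one_div_add_atTop_nhds_zero_nat
  filter_upwards [eventually_gt_atTop j] with n hn
  exact (hdist n j hn).le

theorem isUnit_sub_I {a : H →L[ℂ] H} (ha : IsSelfAdjoint a) : IsUnit (a - Complex.I • 1) := by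
  by_contra h
  have h1 : Complex.I ∈ spectrum ℂ a := by
    rw [spectrum.mem_iff, Algebra.algebraMap_eq_smul_one, ← neg_sub, IsUnit.neg_iff]
    exact h
  simpa using ha.im_eq_zero_of_mem_spectrum h1

/-- For self-adjoint a the cross term vanishes: ‖(a - i)ξ‖² = ‖aξ‖² + ‖ξ‖². -/
theorem norm_ringInverse_sub_I_le {a : H →L[ℂ] H} (ha : IsSelfAdjoint a) :
    ‖Ring.inverse (a - Complex.I • 1)‖ ≤ 1 := by
  have key : ∀ ξ, ‖ξ‖ ≤ ‖(a - Complex.I • 1) ξ‖ := by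
    intro ξ
    have h1 : (inner ℂ (a ξ) ξ).im = 0 := by
      have h2 : inner ℂ (a ξ) ξ = inner ℂ ξ (a ξ) := by
        conv_lhs => rw [← ha.star_eq]
        rw [ContinuousLinearMap.star_eq_adjoint, ContinuousLinearMap.adjoint_inner_left]
      have h3 := inner_conj_symm (𝕜 := ℂ) (a ξ) ξ
      rw [← h2] at h3
      exact Complex.conj_eq_iff_im.1 h3
    have h4 : ‖(a - Complex.I • 1) ξ‖ ^ 2 = ‖a ξ‖ ^ 2 + ‖ξ‖ ^ 2 := by
      have := norm_sub_sq (𝕜 := ℂ) (a ξ) (Complex.I • ξ)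
      rw [inner_smul_right] at this
      simpa [norm_smul, h1] using this
    refine le_of_sq_le_sq ?_ (norm_nonneg _)
    rw [h4]
    exact le_add_of_nonneg_left (by positivity)
  refine ContinuousLinearMap.opNorm_le_bound _ zero_le_one fun ξ => ?_
  rw [one_mul]
  refine (key _).trans_eq ?_
  rw [← mul_apply_eq_comp, Ring.mul_inverse_cancel _ (isUnit_sub_I ha)]
  rfl

/-- Convergence of self-adjoint operators in a dense set of vectors implies strong convergence of
the resolvents. -/
theorem tendsto_ringInverse_sub_I {a : ℕ → H →L[ℂ] H} {x : H →L[ℂ] H}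
    (ha : ∀ n, IsSelfAdjoint (a n)) (hx : IsSelfAdjoint x) {ξ : ℕ → H} (hξ : DenseRange ξ)
    (h : ∀ j, Tendsto (fun n => a n (ξ j)) atTop (𝓝 (x (ξ j)))) (η : H) :
    Tendsto (fun n => (Ring.inverse (a n - Complex.I • 1) -
      Ring.inverse (x - Complex.I • 1)) η) atTop (𝓝 0) := by
  set r : ℕ → H →L[ℂ] H := fun n => Ring.inverse (a n - Complex.I • 1)
  set X := x - Complex.I • (1 : H →L[ℂ] H)
  have hr1 : ∀ n, ‖r n‖ ≤ 1 := fun n => norm_ringInverse_sub_I_le (ha n)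
  have hT : ∀ n, r n * X - 1 = r n * (x - a n) := by
    intro n
    have h1 : X = (x - a n) + (a n - Complex.I • 1) := by simp [X]
    rw [h1, mul_add, Ring.inverse_mul_cancel _ (isUnit_sub_I (ha n)), add_sub_cancel_right]
  -- The operators r n X - 1 are uniformly bounded even if a n is not, so convergence on the dense
  -- sequence suffices. Evaluation at X⁻¹η gives the difference of resolvents.
  have h1 := tendsto_apply_of_denseRange (T := fun n => r n * X - 1) (C := ‖X‖ + ‖(1 : H →L[ℂ] H)‖)
    (fun n => by
      refine (norm_sub_le _ _).trans (add_le_add_left ((norm_mul_le _ _).trans ?_) _)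
      exact mul_le_of_le_one_left (norm_nonneg _) (hr1 n)) hξ (fun j => by
      simp only [hT]
      refine squeeze_zero_norm (a := fun n => ‖x (ξ j) - a n (ξ j)‖) (fun n => ?_) ?_
      · simpa using (r n).le_of_opNorm_le (hr1 n) (x (ξ j) - a n (ξ j))
      · simpa using ((h j).const_sub (x (ξ j))).norm) (Ring.inverse X η)
  refine h1.congr fun n => ?_
  rw [← mul_apply_eq_comp, sub_mul, mul_assoc, Ring.mul_inverse_cancel _ (isUnit_sub_I hx), mul_one,
    one_mul]

end Density

/-! ### Images of von Neumann subalgebras under *-automorphisms. -/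

section Image

variable {H : Type*} [NormedAddCommGroup H] [InnerProductSpace ℂ H] [CompleteSpace H]
  {M : VonNeumannAlgebra H}

theorem mem_of_mul_eq_one {b u : H →L[ℂ] H} (hb : b ∈ M) (h1 : u * b = 1) (h2 : b * u = 1) :
    u ∈ M := by
  have : u = Ring.inverse b := (Ring.inverse_unit ⟨b, u, h2, h1⟩).symm
  rw [this]
  exact ringInverse_mem hb

theorem mem_image_iff {θ : Aut M} {N : SA M} {x : M.toStarSubalgebra} :
    (x : H →L[ℂ] H) ∈ image θ N ↔ (θ.symm x : H →L[ℂ] H) ∈ N.1 := by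
  constructor
  · rintro ⟨y, hy, hyx⟩
    rw [← Subtype.ext hyx, StarAlgEquiv.symm_apply_apply]
    exact hy
  · intro h
    exact ⟨θ.symm x, h, by rw [StarAlgEquiv.apply_symm_apply]⟩

/-- The image of a von Neumann subalgebra, as a star subalgebra. -/
def imageStarSubalgebra (θ : Aut M) (N : SA M) : StarSubalgebra ℂ (H →L[ℂ] H) where
  carrier := image θ N
  mul_mem' := by
    rintro _ _ ⟨x, hx, rfl⟩ ⟨y, hy, rfl⟩
    exact ⟨x * y, mul_mem hx hy, by rw [map_mul]; rfl⟩
  add_mem' := by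
    rintro _ _ ⟨x, hx, rfl⟩ ⟨y, hy, rfl⟩
    exact ⟨x + y, add_mem hx hy, by rw [map_add]; rfl⟩
  algebraMap_mem' c := by
    refine ⟨algebraMap ℂ _ c, N.1.toStarSubalgebra.algebraMap_mem c, ?_⟩
    rw [Algebra.algebraMap_eq_smul_one, map_smul, map_one, Algebra.algebraMap_eq_smul_one]
    rfl
  star_mem' := by
    rintro _ ⟨x, hx, rfl⟩
    exact ⟨star x, star_mem hx, by rw [map_star]; rfl⟩

theorem image_subset (θ : Aut M) (N : SA M) : image θ N ⊆ (M : Set (H →L[ℂ] H)) := by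
  rintro _ ⟨x, -, rfl⟩
  exact (θ x).2

theorem bicommutant_image_subset_of_selfAdjoint [TopologicalSpace.SeparableSpace H] (θ : Aut M)
    (N : SA M) {x : H →L[ℂ] H} (hx : x ∈ (image θ N).centralizer.centralizer)
    (hxs : IsSelfAdjoint x) : x ∈ image θ N := by
  -- The bicommutant of θ(N) lies in M'' = M, so θ⁻¹ can be applied to x.
  have hxM : x ∈ M := by
    rw [← SetLike.mem_coe, ← VonNeumannAlgebra.centralizer_centralizer M]
    exact Set.centralizer_subset (Set.centralizer_subset (image_subset θ N)) hx
  have hξ := TopologicalSpace.denseRange_denseSeq H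
  obtain ⟨a, ha, hlim⟩ := exists_selfAdjoint_seq_of_mem_bicommutant_nat
    (imageStarSubalgebra θ N) hx hxs (TopologicalSpace.denseSeq H)
  have haM : ∀ n, a n ∈ M := fun n => image_subset θ N (ha n).1
  have hsub : ∀ {y : H →L[ℂ] H}, y ∈ M → y - Complex.I • 1 ∈ M := fun hy =>
    sub_mem hy (smul_mem_vn _ (one_mem _))
  let R : ∀ y : H →L[ℂ] H, y ∈ M → M.toStarSubalgebra := fun y hy =>
    ⟨Ring.inverse (y - Complex.I • 1), ringInverse_mem (hsub hy)⟩
  have hR : ∀ y (hy : y ∈ M), IsSelfAdjoint y →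
      R y hy * ((⟨y, hy⟩ : M.toStarSubalgebra) - Complex.I • 1) = 1 ∧
      ((⟨y, hy⟩ : M.toStarSubalgebra) - Complex.I • 1) * R y hy = 1 := fun y hy hys =>
    ⟨Subtype.ext (Ring.inverse_mul_cancel _ (isUnit_sub_I hys)),
      Subtype.ext (Ring.mul_inverse_cancel _ (isUnit_sub_I hys))⟩
  have hR' : ∀ y (hy : y ∈ M), IsSelfAdjoint y →
      θ.symm (R y hy) * (θ.symm ⟨y, hy⟩ - Complex.I • 1) = 1 ∧
      (θ.symm ⟨y, hy⟩ - Complex.I • 1) * θ.symm (R y hy) = 1 := by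
    intro y hy hys
    have h1 := congrArg θ.symm (hR y hy hys).1
    have h2 := congrArg θ.symm (hR y hy hys).2
    rw [map_mul, map_sub, map_smul, map_one] at h1 h2
    exact ⟨h1, h2⟩
  have hRN : ∀ n, (θ.symm (R (a n) (haM n)) : H →L[ℂ] H) ∈ N.1 := by
    intro n
    obtain ⟨h1, h2⟩ := hR' (a n) (haM n) (ha n).2
    have h3 : (θ.symm ⟨a n, haM n⟩ : H →L[ℂ] H) ∈ N.1 := mem_image_iff.1 (ha n).1
    exact mem_of_mul_eq_one (sub_mem h3 (smul_mem_vn Complex.I (one_mem N.1)))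
      (congrArg Subtype.val h1) (congrArg Subtype.val h2)
  have hconv := aut_tendsto_apply θ.symm (x := fun n => R (a n) (haM n) - R x hxM) (C := 1 + 1)
    (fun n => (norm_sub_le _ _).trans
      (add_le_add (norm_ringInverse_sub_I_le (ha n).2) (norm_ringInverse_sub_I_le hxs)))
    (tendsto_ringInverse_sub_I (fun n => (ha n).2) hxs hξ hlim)
  have hRx : (θ.symm (R x hxM) : H →L[ℂ] H) ∈ N.1 := by
    refine mem_of_tendsto_apply hRN fun η => ?_
    rw [tendsto_iff_norm_sub_tendsto_zero]
    have h1 := (hconv η).norm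
    simp only [map_sub, norm_zero] at h1
    exact h1
  -- θ⁻¹(x) - i is the inverse of an element of N, hence in N; adding i recovers θ⁻¹(x).
  obtain ⟨h1, h2⟩ := hR' x hxM hxs
  have h3 : (θ.symm ⟨x, hxM⟩ - Complex.I • 1 : M.toStarSubalgebra).1 ∈ N.1 :=
    mem_of_mul_eq_one hRx (congrArg Subtype.val h2) (congrArg Subtype.val h1)
  refine mem_image_iff (x := ⟨x, hxM⟩).2 ?_
  have h4 := add_mem h3 (smul_mem_vn Complex.I (one_mem N.1))
  have h5 : (θ.symm ⟨x, hxM⟩ - Complex.I • 1 : M.toStarSubalgebra).1 + Complex.I • 1 =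
      (θ.symm ⟨x, hxM⟩ : H →L[ℂ] H) := sub_add_cancel _ _
  rwa [h5] at h4

/-- The image of a von Neumann subalgebra under a `*`-automorphism is a von Neumann algebra. -/
theorem exists_coe_eq_image [TopologicalSpace.SeparableSpace H] (θ : Aut M) (N : SA M) :
    ∃ L : SA M, (L.1 : Set (H →L[ℂ] H)) = image θ N := by
  let P := imageStarSubalgebra θ N
  -- In this form the bicommutant is visibly a star subalgebra, so it contains the real and
  -- imaginary parts of x.
  have hP : (P : Set (H →L[ℂ] H)).centralizer.centralizer =
      StarSubalgebra.centralizer ℂ (StarSubalgebra.centralizer ℂ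
        (P : Set (H →L[ℂ] H)) : Set (H →L[ℂ] H)) := by
    rw [StarSubalgebra.coe_centralizer_centralizer, StarMemClass.star_coe_eq, Set.union_self]
  refine ⟨⟨⟨P, Subset.antisymm (fun x hx => ?_) Set.subset_centralizer_centralizer⟩,
    image_subset θ N⟩, rfl⟩
  have hself : ∀ y : selfAdjoint (H →L[ℂ] H),
      (y : H →L[ℂ] H) ∈ (P : Set (H →L[ℂ] H)).centralizer.centralizer → (y : H →L[ℂ] H) ∈ P :=
    fun y hy => bicommutant_image_subset_of_selfAdjoint θ N hy y.2
  have hx' : x ∈ StarSubalgebra.centralizer ℂ (StarSubalgebra.centralizer ℂ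
      (P : Set (H →L[ℂ] H)) : Set (H →L[ℂ] H)) := hP.subset hx
  have hre := hself (realPart x) (hP.symm.subset (by
    rw [realPart_apply_coe, ← Complex.coe_smul]
    exact StarSubalgebra.smul_mem _ (add_mem hx' (star_mem hx')) _))
  have him := hself (imaginaryPart x) (hP.symm.subset (by
    rw [imaginaryPart_apply_coe, ← Complex.coe_smul]
    exact StarSubalgebra.smul_mem _ (StarSubalgebra.smul_mem _
      (sub_mem hx' (star_mem hx')) _) _))
  have := add_mem hre (P.smul_mem him Complex.I)
  rwa [realPart_add_I_smul_imaginaryPart] at this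

end Image

/-! ### The least subalgebra of full measure and its invariance. -/

section NormalClosure

variable {H : Type*} [NormedAddCommGroup H] [InnerProductSpace ℂ H] [CompleteSpace H]
  {M : VonNeumannAlgebra H}

/-- Only the liminf half of convergence matters: elements of the limit are strong limits of elements
of N. -/
theorem isClosed_subalgebras (N : SA M) : IsClosed (subalgebras N) := by
  rw [isClosed_iff]
  intro K L hK hL y hy
  rw [← SetLike.mem_coe, ← hL.1] at hy
  obtain ⟨-, x, ⟨hx, -⟩, hlim⟩ := hy
  exact mem_of_tendsto_apply (fun n => hK n (hx n)) fun ξ => (hlim ξ).1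

theorem generated_coe (L : VonNeumannAlgebra H) : generated (L : Set (H →L[ℂ] H)) = L := by
  apply SetLike.coe_injective
  rw [coe_generated, StarMemClass.star_coe_eq, Set.union_self,
    VonNeumannAlgebra.centralizer_centralizer]

theorem exists_forall_mem_iff {S : Set (SA M)} (hS : S.Nonempty) :
    ∃ N : SA M, ∀ x, x ∈ N.1 ↔ ∀ L ∈ S, x ∈ L.1 := by
  set s : Set (H →L[ℂ] H) := ⋂ L ∈ S, (L.1 : Set (H →L[ℂ] H)) with hs
  have hle : ∀ L ∈ S, generated s ≤ L.1 := fun L hL => by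
    conv_rhs => rw [← generated_coe L.1]
    exact generated_mono (biInter_subset_of_mem hL)
  obtain ⟨L₀, hL₀⟩ := hS
  refine ⟨⟨generated s, (hle L₀ hL₀).trans L₀.2⟩, fun x => ⟨fun hx L hL => hle L hL hx, ?_⟩⟩
  intro hx
  exact subset_generated s (mem_iInter₂.2 hx)

/-- On a separable Hilbert space, the intersection of a family of von Neumann algebras is
already the intersection of a countable subfamily. -/
theorem exists_countable_forall_mem [TopologicalSpace.SeparableSpace H] (S : Set (SA M)) :
    ∃ T ⊆ S, T.Countable ∧ ∀ x : H →L[ℂ] H, (∀ L ∈ T, x ∈ L.1) → ∀ L ∈ S, x ∈ L.1 := by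
  have hball : ∀ k : ℕ, ∃ T ⊆ S, T.Countable ∧ ∀ x : H →L[ℂ] H, ‖x‖ ≤ k →
      (∀ L ∈ T, x ∈ L.1) → ∀ L ∈ S, x ∈ L.1 := by
    intro k
    let B := {x : H →L[ℂ] H // ‖x‖ ≤ k}
    let f : B → ℕ → H := fun x j => x.1 (TopologicalSpace.denseSeq H j)
    -- On a ball, sequential convergence at the dense vectors is strong convergence, and this
    -- topology is second countable. Each L meets the ball in a closed set, so the Lindelöf property
    -- of the complements gives T.
    let _ : TopologicalSpace B := TopologicalSpace.induced f inferInstance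
    have hf : IsInducing f := ⟨rfl⟩
    have : SecondCountableTopology H := UniformSpace.secondCountable_of_separable H
    have : SecondCountableTopology B := hf.secondCountableTopology
    have hclosed : ∀ L : SA M, IsClosed {x : B | x.1 ∈ L.1} := by
      intro L
      refine IsSeqClosed.isClosed fun x y hx hxy => ?_
      rw [hf.tendsto_nhds_iff, tendsto_pi_nhds] at hxy
      refine mem_of_tendsto_apply hx fun η => ?_
      have h1 := tendsto_apply_of_denseRange (T := fun n => (x n).1 - y.1) (C := k + k)
        (fun n => (norm_sub_le _ _).trans (add_le_add (x n).2 y.2))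
        (TopologicalSpace.denseRange_denseSeq H)
        (fun j => tendsto_sub_nhds_zero_iff.2 (hxy j)) η
      exact tendsto_sub_nhds_zero_iff.1 h1
    obtain ⟨T, hTS, hT, hU⟩ := TopologicalSpace.isOpen_biUnion_countable S
      (fun L : SA M => {x : B | x.1 ∈ L.1}ᶜ) fun L _ => (hclosed L).isOpen_compl
    refine ⟨T, hTS, hT, fun x hxk hx L hL => ?_⟩
    by_contra hxL
    have h1 : (⟨x, hxk⟩ : B) ∈ ⋃ L ∈ S, {x : B | x.1 ∈ L.1}ᶜ := mem_biUnion hL hxL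
    rw [← hU] at h1
    obtain ⟨L', hL', hxL'⟩ := mem_iUnion₂.1 h1
    exact hxL' (hx L' hL')
  choose T hTS hT hmem using hball
  refine ⟨⋃ k, T k, iUnion_subset hTS, countable_iUnion hT, fun x hx => ?_⟩
  obtain ⟨k, hk⟩ := exists_nat_ge ‖x‖
  exact hmem k x hk fun L hL => hx L (mem_iUnion.2 ⟨k, hL⟩)

theorem exists_isLeast_measure_subalgebras_eq_one [TopologicalSpace.SeparableSpace H]
    (μ : Measure (SA M)) [IsProbabilityMeasure μ] :
    ∃ N : SA M, IsLeast {L : SA M | μ (subalgebras L) = 1} N := by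
  have hne : {L : SA M | μ (subalgebras L) = 1}.Nonempty := by
    refine ⟨⟨M, le_rfl⟩, ?_⟩
    have : subalgebras (⟨M, le_rfl⟩ : SA M) = univ := eq_univ_of_forall fun K => K.2
    rw [mem_ofPred_eq, this]
    exact measure_univ
  obtain ⟨N, hN⟩ := exists_forall_mem_iff hne
  obtain ⟨T, hTS, hT, hmem⟩ := exists_countable_forall_mem {L : SA M | μ (subalgebras L) = 1}
  refine ⟨N, ?_, fun L hL x hx => (hN x).1 hx L hL⟩
  have hae : ∀ᵐ K ∂μ, ∀ L ∈ T, K ∈ subalgebras L := (ae_ball_iff hT).2 fun L hL =>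
    (mem_ae_iff_prob_eq_one (isClosed_subalgebras L).measurableSet).2 (hTS hL)
  refine (mem_ae_iff_prob_eq_one (isClosed_subalgebras N).measurableSet).1 ?_
  filter_upwards [hae] with K hK x hx
  exact (hN x).2 (hmem x fun L hL => hK L hL hx)

theorem subset_image_of_isIRA [TopologicalSpace.SeparableSpace H] {Γ : Type*} [Group Γ]
    {α : Γ →* Aut M} {μ : Measure (SA M)} (hμ : IsIRA α μ) {N : SA M}
    (hN : IsLeast {L : SA M | μ (subalgebras L) = 1} N) (g : Γ) :
    (N.1 : Set (H →L[ℂ] H)) ⊆ image (α g) N := by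
  have := hμ.isProbabilityMeasure
  obtain ⟨L, hL⟩ := exists_coe_eq_image (α g) N
  have hone : μ (subalgebras L) = 1 := by
    refine le_antisymm prob_le_one ?_
    -- If α_{g⁻¹}(K) ⊆ N then K ⊆ α_g(N), hence the inverse of g here.
    rw [← hN.1, ← hμ.invariant g⁻¹ _ (isClosed_subalgebras N).measurableSet]
    refine measure_mono ?_
    rintro K ⟨K', hK', hKK'⟩ x hx
    rw [← SetLike.mem_coe, hL]
    have hxM : x ∈ M := K.2 hx
    refine mem_image_iff (x := ⟨x, hxM⟩).2 (hK' ?_)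
    rw [← SetLike.mem_coe, hKK', map_inv]
    exact ⟨⟨x, hxM⟩, hx, rfl⟩
  rw [← hL]
  exact hN.2 hone

theorem image_eq_of_isIRA [TopologicalSpace.SeparableSpace H] {Γ : Type*} [Group Γ]
    {α : Γ →* Aut M} {μ : Measure (SA M)} (hμ : IsIRA α μ) {N : SA M}
    (hN : IsLeast {L : SA M | μ (subalgebras L) = 1} N) (g : Γ) :
    image (α g) N = (N.1 : Set (H →L[ℂ] H)) := by
  refine Subset.antisymm ?_ (subset_image_of_isIRA hμ hN g)
  rintro _ ⟨x, hx, rfl⟩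
  have h := mem_image_iff.1 (subset_image_of_isIRA hμ hN g⁻¹ hx)
  rw [map_inv] at h
  exact h

end NormalClosure

end IRA

theorem mainTheorem8 {H : Type*} [NormedAddCommGroup H] [InnerProductSpace ℂ H] [CompleteSpace H]
    [TopologicalSpace.SeparableSpace H] (M : VonNeumannAlgebra H)
    {Γ : Type*} [Group Γ] (α : Γ →* IRA.Aut M)
    (μ : Measure (IRA.SA M)) (hμ : IRA.IsIRA α μ) :
    (∃! N : IRA.SA M, IRA.IsNormalClosure μ N) ∧
      ∀ N : IRA.SA M, IRA.IsNormalClosure μ N →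
        (∀ L : IRA.SA M, μ (IRA.subalgebras L) = 1 → N ≤ L) ∧
        ∀ g : Γ, IRA.image (α g) N = (N.1 : Set (H →L[ℂ] H)) := by
  have := hμ.isProbabilityMeasure
  obtain ⟨N₀, hN₀⟩ := IRA.exists_isLeast_measure_subalgebras_eq_one μ
  have huniq : ∀ N, IRA.IsNormalClosure μ N → N = N₀ := fun N hN =>
    le_antisymm (hN.2 hN₀.1 (hN₀.2 hN.1)) (hN₀.2 hN.1)
  refine ⟨⟨N₀, ⟨hN₀.1, fun L hL _ => hN₀.2 hL⟩, huniq⟩, fun N hN => ?_⟩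
  obtain rfl := huniq N hN
  exact ⟨fun L hL => hN₀.2 hL, IRA.image_eq_of_isIRA hμ hN₀⟩
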